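/- Let $(\Omega,\mathcal A,\nu)$ be a probability space, $H=L_2(\Omega,\mathcal A,\nu)$ the complex Hilbert space with $\langle f,g\rangle=\int\bar f g\,d\nu$, and $\rho$ a state on $H$, i.e. a positive trace-class operator with $\operatorname{tr}\rho=1$. For $A\in\mathcal A$ (an event) put $\mu(A)=|\chi_A\rangle\langle\chi_A|$ and $\mu_\rho(A)=\operatorname{tr}(\rho\,\mu(A))$. A random variable is a real-valued $f\in H$. Its quantization is the bounded operator $\hat f$ on $H$ given for $f\ge 0$ by $(\hat f g)(y)=\int\min[f(x),f(y)]\,g(x)\,d\nu(x)$, and in general by $\hat f=(f^+)^\wedge-(f^-)^\wedge$ with $f^+=\max(f,0)$, $f^-=-\min(f,0)$. Define $\int f\,d\mu_\rho=\operatorname{tr}(\rho\hat f)$ and $\int_A f\,d\mu_\rho=\int\chi_A f\,d\mu_\rho$. As usual in $L_2$, pointwise conditions on random variables are required only $\nu$-almost everywhere; the support of $f$ is $\{x: f(x)\neq 0\}$. Then $\rho\,\mu(A)$ and $\rho\hat f$ have well-defined traces (the series $\sum_i\langle e_i,\rho\,\mu(A)e_i\rangle$ and $\sum_i\langle e_i,\rho\hat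 f e_i\rangle$ converge absolutely, with sum independent of the orthonormal basis $(e_i)$ of $H$), the numbers $\mu_\rho(A)$ and $\int f\,d\mu_\rho$ are real, and: (a) For all $A\in\mathcal A$, $\int\chi_A\,d\mu_\rho=\mu_\rho(A)$. (b) For all $\alpha\in\mathbb R$ and all random variables $f$, $\int\alpha f\,d\mu_\rho=\alpha\int f\,d\mu_\rho$. (c) If $f_1\le f_2\le\cdots$ is an increasing sequence of random variables $f_i\ge 0$ converging pointwise to a random variable $f$, then $\lim_i\int f_i\,d\mu_\rho=\int f\,d\mu_\rho$. (d) If $f\ge 0$ is a random variable, then $\int f\,d\mu_\rho\ge 0$. (e) If $f,g,h$ are random variables with mutually disjoint supports, then $$\int(f+g+h)\,d\mu_\rho=\int(f+g)\,d\mu_\rho+\int(f+h)\,d\mu_\rho+\int(g+h)\,d\mu_\rho-\int f\,d\mu_\rho-\int g\,d\mu_\rho-\int h\,d\mu_\rho.$$ (f) If $f$ is a random variable and $A,B,C\in\mathcal A$ are mutually disjoint, then $$\int_{A\cup B\cup C}f\,d\mu_\rho=\int_{A\cup B}f\,d\mu_\rho+\int_{A\cup C}f\,d\mu_\rho+\int_{B\cup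 C}f\,d\mu_\rho-\int_A f\,d\mu_\rho-\int_B f\,d\mu_\rho-\int_C f\,d\mu_\rho.$$ -/

import Mathlib

open MeasureTheory Filter Topology

open scoped ENNReal ComplexOrder

universe u

namespace QMeasure

section Trace

variable {H : Type u} [NormedAddCommGroup H] [InnerProductSpace ℂ H]

/-- The bounded operator `T` is of trace class with trace `t`: over every Hilbert basis `b`, the
series `∑ i, ⟪b i, T (b i)⟫` converges unconditionally (equivalently, absolutely), with sum `t`. -/
def HasTrace (T : H →L[ℂ] H) (t : ℂ) : Prop :=
  ∀ ⦃ι : Type u⦄ (b : HilbertBasis ι ℂ H), HasSum (fun i => inner ℂ (b i) (T (b i))) t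

/-- The trace `tr T = ∑ i, ⟪b i, T (b i)⟫`, computed in some Hilbert basis `b` of `H`. It is the
trace in every basis as soon as `T` is of trace class, see `HasTrace`. -/
noncomputable def trace [CompleteSpace H] (T : H →L[ℂ] H) : ℂ :=
  ∑' i, inner ℂ ((exists_hilbertBasis ℂ H).choose_spec.choose i)
    (T ((exists_hilbertBasis ℂ H).choose_spec.choose i))

/-- A state (density operator): a positive operator of trace class with trace one. -/
def IsDensityOperator (ρ : H →L[ℂ] H) : Prop :=
  ρ.IsPositive ∧ HasTrace ρ 1

theorem HasTrace.trace_eq [CompleteSpace H] {T : H →L[ℂ] H} {t : ℂ} (h : HasTrace T t) :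
    trace T = t :=
  (h _).tsum_eq

end Trace

section Quantization

variable {Ω : Type u} [MeasurableSpace Ω] {ν : Measure Ω} [IsProbabilityMeasure ν]

/-- The characteristic function of an event is a random variable. -/
theorem memLp_chi {A : Set Ω} (hA : MeasurableSet A) :
    MemLp (A.indicator (fun _ => (1 : ℝ))) 2 ν :=
  (memLp_const 1).indicator hA

theorem memLp_section {f : Ω → ℝ} (hf : MemLp f 2 ν) (c : ℝ) :
    MemLp (fun x => ((min (f x) c : ℝ) : ℂ)) 2 ν :=
  (hf.inf (memLp_const c)).ofReal

theorem norm_section_le {f : Ω → ℝ} (hf : MemLp f 2 ν) (c : ℝ) :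
    ‖(memLp_section hf c).toLp‖ ≤ ‖hf.toLp‖ + |c| := by
  have h2 : ‖(memLp_section hf c).toLp‖ ≤
      ‖(hf.norm.add ((memLp_const c).norm (μ := ν) (p := 2))).toLp‖ := by
    refine Lp.norm_le_norm_of_ae_le ?_
    filter_upwards [(memLp_section hf c).coeFn_toLp,
      (hf.norm.add ((memLp_const c).norm (μ := ν) (p := 2))).coeFn_toLp] with x hx hy
    rw [hx, hy, Complex.norm_real]
    simp only [Pi.add_apply, Real.norm_eq_abs]
    rw [abs_of_nonneg (add_nonneg (abs_nonneg (f x)) (abs_nonneg c))]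
    rcases min_choice (f x) c with h | h <;> rw [h] <;> simp
  refine h2.trans ?_
  rw [MemLp.toLp_add hf.norm ((memLp_const c).norm (μ := ν) (p := 2))]
  refine (norm_add_le _ _).trans (add_le_add (le_of_eq ?_) (le_of_eq ?_))
  · rw [Lp.norm_toLp, Lp.norm_toLp, eLpNorm_norm]
  · rw [Lp.norm_toLp, eLpNorm_norm, eLpNorm_const c two_ne_zero (IsProbabilityMeasure.ne_zero ν)]
    simp

theorem integral_section {f : Ω → ℝ} (hf : MemLp f 2 ν) (g : Lp ℂ 2 ν) (c : ℝ) :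
    ∫ x, ((min (f x) c : ℝ) : ℂ) * g x ∂ν = inner ℂ (memLp_section hf c).toLp g := by
  rw [L2.inner_def]
  refine integral_congr_ae ?_
  filter_upwards [(memLp_section hf c).coeFn_toLp] with x hx
  rw [hx]
  simp [mul_comm]

theorem norm_integral_section_le {f : Ω → ℝ} (hf : MemLp f 2 ν) (g : Lp ℂ 2 ν) (c : ℝ) :
    ‖∫ x, ((min (f x) c : ℝ) : ℂ) * g x ∂ν‖ ≤ (‖hf.toLp‖ + |c|) * ‖g‖ := by
  rw [integral_section hf]
  exact (norm_inner_le_norm _ _).trans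
    (mul_le_mul_of_nonneg_right (norm_section_le hf c) (norm_nonneg g))

theorem memLp_bound {f : Ω → ℝ} (hf : MemLp f 2 ν) :
    MemLp (fun y => ‖hf.toLp‖ + |f y|) 2 ν :=
  (memLp_const ‖hf.toLp‖ : MemLp (fun _ : Ω => ‖hf.toLp‖) 2 ν).add hf.norm

theorem memLp_minKernel {f : Ω → ℝ} (hf : MemLp f 2 ν) (g : Lp ℂ 2 ν) :
    MemLp (fun y => ∫ x, ((min (f x) (f y) : ℝ) : ℂ) * g x ∂ν) 2 ν := by
  refine MemLp.of_le_mul (c := ‖g‖) (memLp_bound hf) ?_ (Eventually.of_forall fun y => ?_)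
  · have h1 : AEStronglyMeasurable (fun p : Ω × Ω => f p.2) (ν.prod ν) := hf.1.comp_snd
    have h2 : AEStronglyMeasurable (fun p : Ω × Ω => f p.1) (ν.prod ν) := hf.1.comp_fst
    have h3 : AEStronglyMeasurable (fun p : Ω × Ω => g p.2) (ν.prod ν) :=
      (Lp.aestronglyMeasurable g).comp_snd
    have h4 : AEStronglyMeasurable
        (fun p : Ω × Ω => ((min (f p.2) (f p.1) : ℝ) : ℂ) * g p.2) (ν.prod ν) :=
      (Complex.continuous_ofReal.comp_aestronglyMeasurable (h1.inf h2)).mul h3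
    exact h4.integral_prod_right'
  · refine (norm_integral_section_le hf g (f y)).trans (le_of_eq ?_)
    rw [Real.norm_of_nonneg (by positivity), mul_comm]

variable (ν) in
/-- The bounded operator `g ↦ (y ↦ ∫ min (f x) (f y) * g x dν(x))` on `L²(Ω, ν; ℂ)`. -/
noncomputable def minKernelOp (f : Ω → ℝ) (hf : MemLp f 2 ν) : Lp ℂ 2 ν →L[ℂ] Lp ℂ 2 ν :=
  LinearMap.mkContinuous
    { toFun := fun g => (memLp_minKernel hf g).toLp
      map_add' := fun g h => by
        rw [← MemLp.toLp_add]
        congr 1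
        funext y
        simp only [Pi.add_apply, integral_section hf, inner_add_right]
      map_smul' := fun c g => by
        rw [RingHom.id_apply, ← MemLp.toLp_const_smul]
        congr 1
        funext y
        simp only [Pi.smul_apply, integral_section hf, inner_smul_right, smul_eq_mul] }
    ‖(memLp_bound hf).toLp‖
    (fun g => by
      rw [mul_comm]
      refine Lp.norm_le_mul_norm_of_ae_le_mul ?_
      filter_upwards [(memLp_minKernel hf g).coeFn_toLp, (memLp_bound hf).coeFn_toLp] with y h1 h2
      refine (le_of_eq (congrArg norm h1)).trans ((norm_integral_section_le hf g (f y)).trans ?_)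
      rw [h2, mul_comm]
      exact mul_le_mul_of_nonneg_left (le_abs_self _) (norm_nonneg g))

/-- The defining formula of the operator, for almost every `y`. -/
theorem minKernelOp_apply_ae (f : Ω → ℝ) (hf : MemLp f 2 ν) (g : Lp ℂ 2 ν) :
    minKernelOp ν f hf g =ᵐ[ν] fun y => ∫ x, ((min (f x) (f y) : ℝ) : ℂ) * g x ∂ν :=
  (memLp_minKernel hf g).coeFn_toLp

theorem memLp_posPart {f : Ω → ℝ} (hf : MemLp f 2 ν) : MemLp (fun x => max (f x) 0) 2 ν :=
  hf.sup (memLp_const 0)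

theorem memLp_negPart {f : Ω → ℝ} (hf : MemLp f 2 ν) : MemLp (fun x => -min (f x) 0) 2 ν :=
  (hf.inf (memLp_const 0)).neg

variable (ν) in
/-- The quantization `f̂ = (f⁺)^ - (f⁻)^` of a random variable `f`, that is, of a real-valued
square-integrable function, where `f⁺ = max f 0`, `f⁻ = - min f 0` and, for a nonnegative random
variable `h`, `(ĥ g)(y) = ∫ min (h x) (h y) * g x dν(x)`. -/
noncomputable def quantization (f : Ω → ℝ) (hf : MemLp f 2 ν) : Lp ℂ 2 ν →L[ℂ] Lp ℂ 2 ν :=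
  minKernelOp ν (fun x => max (f x) 0) (memLp_posPart hf) -
    minKernelOp ν (fun x => -min (f x) 0) (memLp_negPart hf)

/-- For a nonnegative `f` the quantization is the operator with kernel `min (f x) (f y)`. -/
theorem quantization_of_nonneg (f : Ω → ℝ) (hf : MemLp f 2 ν) (h0 : ∀ x, 0 ≤ f x) :
    quantization ν f hf = minKernelOp ν f hf := by
  have h1 : (fun x => max (f x) 0) = f := funext fun x => max_eq_left (h0 x)
  have h2 : (fun x => -min (f x) 0) = fun _ => (0 : ℝ) := funext fun x => by
    rw [min_eq_right (h0 x), neg_zero]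
  have h3 : minKernelOp ν (fun x => -min (f x) 0) (memLp_negPart hf) = 0 := by
    ext1 g
    refine Lp.ext ?_
    refine (minKernelOp_apply_ae _ _ g).trans ?_
    filter_upwards [Lp.coeFn_zero ℂ 2 ν] with y hy
    have h4 : ∀ x, -min (f x) 0 = 0 := congrFun h2
    simp only [h4, min_self, Complex.ofReal_zero, zero_mul, integral_zero]
    exact hy.symm
  rw [quantization, h3, sub_zero]
  simp only [h1]

variable (ν) in
/-- The vector `χ_A` of `L²(Ω, ν; ℂ)`, for an event `A`. -/
noncomputable def chi (A : Set Ω) (hA : MeasurableSet A) : Lp ℂ 2 ν :=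
  indicatorConstLp 2 hA (measure_ne_top ν A) (1 : ℂ)

variable (ν) in
/-- The decoherence operator `D(A, B) = |χ_A⟩⟨χ_B|`. -/
noncomputable def decoherenceOp (A B : Set Ω) (hA : MeasurableSet A) (hB : MeasurableSet B) :
    Lp ℂ 2 ν →L[ℂ] Lp ℂ 2 ν :=
  InnerProductSpace.rankOne ℂ (chi ν A hA) (chi ν B hB)

variable (ν) in
/-- The `q`-measure operator `μ(A) = D(A, A)`. -/
noncomputable def qMeasureOp (A : Set Ω) (hA : MeasurableSet A) : Lp ℂ 2 ν →L[ℂ] Lp ℂ 2 ν :=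
  decoherenceOp ν A A hA hA

/-- The `q`-measure `μ_ρ(A) = tr(ρ μ(A))`. -/
noncomputable def qMeasure (ρ : Lp ℂ 2 ν →L[ℂ] Lp ℂ 2 ν) (A : Set Ω) (hA : MeasurableSet A) : ℂ :=
  trace (ρ ∘L qMeasureOp ν A hA)

/-- The `q`-integral `∫ f dμ_ρ = tr(ρ f̂)` of a random variable `f`. -/
noncomputable def qIntegral (ρ : Lp ℂ 2 ν →L[ℂ] Lp ℂ 2 ν) (f : Ω → ℝ) (hf : MemLp f 2 ν) : ℂ :=
  trace (ρ ∘L quantization ν f hf)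

/-- The `q`-integral over an event, `∫_A f dμ_ρ = ∫ χ_A f dμ_ρ`. -/
noncomputable def qSetIntegral (ρ : Lp ℂ 2 ν →L[ℂ] Lp ℂ 2 ν) (A : Set Ω) (hA : MeasurableSet A)
    (f : Ω → ℝ) (hf : MemLp f 2 ν) : ℂ :=
  qIntegral ρ (A.indicator f) (hf.indicator hA)

end Quantization

end QMeasure

/-! Write `ρ = S * S` with `S` selfadjoint. Since `tr ρ = 1`, `S` is Hilbert-Schmidt, so `tr (ρ T) =
∑ ⟪S c_j, T (S c_j)⟫` is a bounded positive linear functional `τ` of the bounded operator `T`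
(`IsDensityOperator.exists_functional`). Every claim thereby becomes one about the operators `f̂`,
whose kernel is `signedMin (f x) (f y)`. That kernel depends only on the two values of `f`, so (a),
(b) and (e) are identities between real numbers, and (f) is (e) for the restrictions of `f`. For
(c), `f ↦ f̂` is Lipschitz from L² to the operator norm (`norm_quantization_sub_le`), and the
sequence converges in L². For (d), the layer cake formula exhibits `min` as a positive semidefinite
kernel (`exists_integral_min_eq`). Reality follows, as `f̂` is a difference of positive operators.
-/

namespace QMeasure

/-! ### The trace against a state as a bounded positive functional. -/

section TraceFunctional

variable {H : Type u} [NormedAddCommGroup H] [InnerProductSpace ℂ H]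

/-- Parseval's identity. -/
theorem hasSum_norm_inner_sq {ι : Type*} (b : HilbertBasis ι ℂ H) (x : H) :
    HasSum (fun i => ‖(inner ℂ (b i) x : ℂ)‖ ^ 2) (‖x‖ ^ 2) := by
  have h := (b.hasSum_inner_mul_inner x x).mapL Complex.reCLM
  convert h using 2 with i
  · rw [← inner_conj_symm, RCLike.norm_conj, Complex.mul_conj, Complex.normSq_eq_norm_sq,
      Complex.reCLM_apply, Complex.ofReal_re]
  · rw [inner_self_eq_norm_sq_to_K]
    exact (Complex.ofReal_re _).symm.trans (by simp)

variable [CompleteSpace H]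

/-- Parseval in `b` sums each row to `‖C* c_j‖²`. -/
theorem summable_norm_inner_sq {ι κ : Type*} (b : HilbertBasis ι ℂ H) (c : HilbertBasis κ ℂ H)
    (C : H →L[ℂ] H) (hC : Summable fun j => ‖C.adjoint (c j)‖ ^ 2) :
    Summable fun p : ι × κ => ‖(inner ℂ (c p.2) (C (b p.1)) : ℂ)‖ ^ 2 := by
  refine (Equiv.prodComm κ ι).summable_iff.mp ?_
  have h (j : κ) : HasSum (fun i => ‖(inner ℂ (c j) (C (b i)) : ℂ)‖ ^ 2)
      (‖C.adjoint (c j)‖ ^ 2) := by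
    convert hasSum_norm_inner_sq b (C.adjoint (c j)) using 3 with i
    rw [← ContinuousLinearMap.adjoint_inner_left, ← inner_conj_symm, RCLike.norm_conj]
  refine (summable_prod_of_nonneg fun p => sq_nonneg _).mpr ⟨fun j => (h j).summable, ?_⟩
  convert hC using 2 with j
  exact (h j).tsum_eq

theorem exists_mul_self_eq {ρ : H →L[ℂ] H} (hρ : ρ.IsPositive) :
    ∃ S : H →L[ℂ] H, S.adjoint = S ∧ S ∘L S = ρ := by
  have h0 : 0 ≤ ρ := (ContinuousLinearMap.nonneg_iff_isPositive ρ).mpr hρ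
  refine ⟨CFC.sqrt ρ, ?_, CFC.sqrt_mul_sqrt_self ρ h0⟩
  exact (CFC.sqrt_nonneg ρ).isSelfAdjoint

theorem hasSum_norm_sq_of_hasTrace {ρ S : H →L[ℂ] H} {t : ℝ} (hS : S.adjoint = S)
    (hρ : S ∘L S = ρ) (h : HasTrace ρ t) {ι : Type u} (b : HilbertBasis ι ℂ H) :
    HasSum (fun i => ‖S (b i)‖ ^ 2) t := by
  have h1 := (h b).mapL Complex.reCLM
  convert h1 using 2 with i
  rw [← hρ, ContinuousLinearMap.comp_apply, ← ContinuousLinearMap.adjoint_inner_left, hS,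
    inner_self_eq_norm_sq_to_K]
  · norm_cast
  · simp

/-- Cyclicity of the trace, `tr (S * S * T) = tr (S * T * S)`, for a selfadjoint Hilbert-Schmidt
operator `S`, with the two traces computed in different bases. -/
theorem hasSum_inner_mul_self_comp {S : H →L[ℂ] H} (T : H →L[ℂ] H) (hS : S.adjoint = S)
    {ι κ : Type*} (b : HilbertBasis ι ℂ H) (c : HilbertBasis κ ℂ H)
    (hc : Summable fun j => ‖S (c j)‖ ^ 2) :
    HasSum (fun i => (inner ℂ (b i) (S (S (T (b i)))) : ℂ))
      (∑' j, inner ℂ (S (c j)) (T (S (c j)))) := by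
  have h1 : Summable fun p : ι × κ => ‖(inner ℂ (c p.2) (S (b p.1)) : ℂ)‖ ^ 2 :=
    summable_norm_inner_sq b c S (by rwa [hS])
  have h2 : Summable fun p : ι × κ => ‖(inner ℂ (c p.2) (S (T (b p.1))) : ℂ)‖ ^ 2 := by
    refine summable_norm_inner_sq b c (S ∘L T) ?_
    refine Summable.of_nonneg_of_le (fun j => by positivity) (fun j => ?_)
      (hc.mul_left (‖T.adjoint‖ ^ 2))
    rw [ContinuousLinearMap.adjoint_comp, hS, ← mul_pow, ContinuousLinearMap.comp_apply]
    gcongr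
    exact T.adjoint.le_opNorm _
  -- Both traces are iterated sums of this double family, by Parseval in `c` and in `b`
  -- respectively. Absolute summability, from `|zw| ≤ |z|² + |w|²`, allows the exchange.
  have h3 : Summable fun p : ι × κ =>
      (inner ℂ (S (b p.1)) (c p.2) : ℂ) * inner ℂ (c p.2) (S (T (b p.1))) := by
    refine Summable.of_norm_bounded (h1.add h2) fun p => ?_
    rw [norm_mul, norm_inner_symm]
    nlinarith [sq_nonneg (‖(inner ℂ (c p.2) (S (b p.1)) : ℂ)‖ -
      ‖(inner ℂ (c p.2) (S (T (b p.1))) : ℂ)‖),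
      sq_nonneg ‖(inner ℂ (c p.2) (S (b p.1)) : ℂ)‖,
      sq_nonneg ‖(inner ℂ (c p.2) (S (T (b p.1))) : ℂ)‖]
  obtain ⟨t, ht⟩ := h3
  have h4 : HasSum (fun i => (inner ℂ (b i) (S (S (T (b i)))) : ℂ)) t := by
    convert ht.prod_fiberwise fun i => c.hasSum_inner_mul_inner (S (b i)) (S (T (b i))) using 2
      with i
    rw [← ContinuousLinearMap.adjoint_inner_left, hS]
  have h5 : HasSum (fun j => (inner ℂ (S (c j)) (T (S (c j))) : ℂ)) t := by
    refine HasSum.prod_fiberwise ((Equiv.prodComm κ ι).hasSum_iff.mpr ht) fun j => ?_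
    rw [← ContinuousLinearMap.adjoint_inner_left]
    refine (b.hasSum_inner_mul_inner (T.adjoint (S (c j))) (S (c j))).congr_fun fun i => ?_
    have hS' (x y : H) : (inner ℂ (S x) y : ℂ) = inner ℂ x (S y) := by
      rw [← ContinuousLinearMap.adjoint_inner_left, hS]
    rw [ContinuousLinearMap.adjoint_inner_left, hS', ← hS' (b i), mul_comm]
    rfl
  rwa [h5.tsum_eq]

/-- The functional `T ↦ tr (ρ * T)` defined by a state `ρ`. -/
theorem IsDensityOperator.exists_functional {ρ : H →L[ℂ] H} (hρ : IsDensityOperator ρ) :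
    ∃ τ : (H →L[ℂ] H) →L[ℂ] ℂ, (∀ T, HasTrace (ρ ∘L T) (τ T)) ∧
      ∀ T : H →L[ℂ] H, T.IsPositive → 0 ≤ τ T := by
  obtain ⟨S, hS, rfl⟩ := exists_mul_self_eq hρ.1
  obtain ⟨w, c, -⟩ := exists_hilbertBasis ℂ H
  have hc : HasSum (fun j => ‖S (c j)‖ ^ 2) (1 : ℝ) :=
    hasSum_norm_sq_of_hasTrace hS rfl (by simpa using hρ.2) c
  have hb (T : H →L[ℂ] H) (j : w) :
      ‖(inner ℂ (S (c j)) (T (S (c j))) : ℂ)‖ ≤ ‖T‖ * ‖S (c j)‖ ^ 2 := by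
    refine (norm_inner_le_norm _ _).trans ?_
    nlinarith [T.le_opNorm (S (c j)), norm_nonneg (S (c j))]
  have hs (T : H →L[ℂ] H) : Summable fun j => (inner ℂ (S (c j)) (T (S (c j))) : ℂ) :=
    Summable.of_norm_bounded (hc.summable.mul_left ‖T‖) (hb T)
  -- The functional is defined in the one basis `c`; cyclicity gives the same value in every basis.
  -- The bound `1` is `∑ ‖S c_j‖² = tr ρ`.
  refine ⟨LinearMap.mkContinuous
    { toFun := fun T => ∑' j, inner ℂ (S (c j)) (T (S (c j)))
      map_add' := fun T U => by
        rw [← (hs T).tsum_add (hs U)]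
        simp only [add_apply, inner_add_right]
      map_smul' := fun a T => by
        rw [RingHom.id_apply, smul_eq_mul, ← tsum_mul_left]
        simp only [smul_apply, inner_smul_right] } 1 (fun T => ?_),
    fun T ι b => ?_, fun T hT => ?_⟩
  · have h := tsum_of_norm_bounded (hc.mul_left ‖T‖) (hb T)
    rwa [mul_one, ← one_mul ‖T‖] at h
  · exact hasSum_inner_mul_self_comp T hS b c hc.summable
  · exact tsum_nonneg fun j => hT.inner_nonneg_right _

end TraceFunctional

/-! ### The scalar kernel. -/

/-- The kernel `min(a⁺, b⁺) - min(a⁻, b⁻)` of the quantization. -/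
def signedMin (a b : ℝ) : ℝ :=
  min (max a 0) (max b 0) - min (-min a 0) (-min b 0)

theorem signedMin_of_nonneg {a b : ℝ} (ha : 0 ≤ a) (hb : 0 ≤ b) : signedMin a b = min a b := by
  simp [signedMin, ha, hb]

theorem signedMin_zero_left (b : ℝ) : signedMin 0 b = 0 := by
  rcases le_total 0 b with h | h <;> simp [signedMin, h]

theorem signedMin_zero_right (a : ℝ) : signedMin a 0 = 0 := by
  rcases le_total 0 a with h | h <;> simp [signedMin, h]

/-- A negative factor exchanges positive and negative parts, so the kernel is odd under a joint
change of sign. -/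
theorem signedMin_mul (α a b : ℝ) : signedMin (α * a) (α * b) = α * signedMin a b := by
  have key {β : ℝ} (hβ : 0 ≤ β) : signedMin (β * a) (β * b) = β * signedMin a b := by
    have h1 (c : ℝ) : max (β * c) 0 = β * max c 0 := by
      rw [mul_max_of_nonneg _ _ hβ, mul_zero]
    have h2 (c : ℝ) : -min (β * c) 0 = β * -min c 0 := by
      rw [mul_neg, mul_min_of_nonneg _ _ hβ, mul_zero]
    simp only [signedMin, h1, h2, ← mul_min_of_nonneg _ _ hβ, mul_sub]
  have hneg (a b : ℝ) : signedMin (-a) (-b) = -signedMin a b := by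
    have h1 (c : ℝ) : max (-c) 0 = -min c 0 := by rw [← max_neg_neg, neg_zero]
    have h2 (c : ℝ) : -min (-c) 0 = max c 0 := by rw [← max_neg_neg, neg_neg, neg_zero]
    simp only [signedMin, h1, h2, neg_sub]
  rcases le_total 0 α with h | h
  · exact key h
  · have := key (neg_nonneg.mpr h)
    rw [neg_mul, neg_mul, hneg, neg_mul] at this
    linarith

/-- Positive and negative parts are 1-Lipschitz; the 2 counts the two minima. -/
theorem abs_signedMin_sub_le (a b a' b' : ℝ) :
    |signedMin a b - signedMin a' b'| ≤ 2 * (|a - a'| + |b - b'|) := by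
  have h1 (s t s' t' : ℝ) : |min s t - min s' t'| ≤ |s - s'| + |t - t'| :=
    (abs_min_sub_min_le_max s t s' t').trans (max_le_add_of_nonneg (abs_nonneg _) (abs_nonneg _))
  have h2 (s t : ℝ) : |max s 0 - max t 0| ≤ |s - t| := abs_max_sub_max_le_abs s t 0
  have h3 (s t : ℝ) : |-min s 0 - -min t 0| ≤ |s - t| := by
    rw [neg_sub_neg, abs_sub_comm]
    simpa using abs_min_sub_min_le_max s 0 t 0
  have h4 := h1 (max a 0) (max b 0) (max a' 0) (max b' 0)
  have h5 := h1 (-min a 0) (-min b 0) (-min a' 0) (-min b' 0)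
  have h6 := abs_sub (min (max a 0) (max b 0) - min (max a' 0) (max b' 0))
    (min (-min a 0) (-min b 0) - min (-min a' 0) (-min b' 0))
  rw [signedMin, signedMin, sub_sub_sub_comm]
  linarith [h2 a a', h2 b b', h3 a a', h3 b b']

/-- The grade-2 additivity of the kernel for functions with disjoint supports. -/
theorem signedMin_add_add {a b c a' b' c' : ℝ} (hab : a = 0 ∨ b = 0) (hac : a = 0 ∨ c = 0)
    (hbc : b = 0 ∨ c = 0) (hab' : a' = 0 ∨ b' = 0) (hac' : a' = 0 ∨ c' = 0)
    (hbc' : b' = 0 ∨ c' = 0) :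
    signedMin (a + b + c) (a' + b' + c') =
      signedMin (a + b) (a' + b') + signedMin (a + c) (a' + c') + signedMin (b + c) (b' + c') -
        signedMin a a' - signedMin b b' - signedMin c c' := by
  -- At each of the two points at most one function is nonzero, which leaves nine cases, each
  -- involving at most two of the functions.
  have h {x y z : ℝ} (h1 : x = 0 ∨ y = 0) (h2 : x = 0 ∨ z = 0) (h3 : y = 0 ∨ z = 0) :
      (y = 0 ∧ z = 0) ∨ (x = 0 ∧ z = 0) ∨ (x = 0 ∧ y = 0) := by tauto
  rcases h hab hac hbc with ⟨rfl, rfl⟩ | ⟨rfl, rfl⟩ | ⟨rfl, rfl⟩ <;>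
  rcases h hab' hac' hbc' with ⟨rfl, rfl⟩ | ⟨rfl, rfl⟩ | ⟨rfl, rfl⟩ <;>
  simp [signedMin_zero_left, signedMin_zero_right]

theorem integral_Ioi_ite_lt {E : Type*} [NormedAddCommGroup E] [NormedSpace ℝ E] [CompleteSpace E]
    {m : ℝ} (hm : 0 ≤ m) (z : E) :
    ∫ t in Set.Ioi (0 : ℝ), (if t < m then z else 0) = m • z := by
  have h : (fun t : ℝ => if t < m then z else 0) = (Set.Iio m).indicator fun _ => z := by
    ext t
    simp [Set.indicator_apply]
  rw [h, integral_indicator_const _ measurableSet_Iio, measureReal_restrict_apply measurableSet_Iio,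
    Set.inter_comm, Set.Ioi_inter_Iio, Real.volume_real_Ioo_of_le hm, sub_zero]

/-! ### L² estimates and the Lipschitz bound for the quantization. -/

section Quantization

variable {Ω : Type u} [MeasurableSpace Ω] {ν : Measure Ω}

theorem integrable_ofReal_mul {k : Ω → ℝ} (hk : MemLp k 2 ν) (g : Lp ℂ 2 ν) :
    Integrable (fun x => (k x : ℂ) * g x) ν :=
  MemLp.integrable_mul (p := 2) (q := 2) hk.ofReal (Lp.memLp g)

theorem norm_integral_ofReal_mul_le {k b : Ω → ℝ} (hk : MemLp k 2 ν) (hb : MemLp b 2 ν)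
    (h : ∀ x, |k x| ≤ b x) (g : Lp ℂ 2 ν) :
    ‖∫ x, (k x : ℂ) * g x ∂ν‖ ≤ ‖hb.toLp‖ * ‖g‖ := by
  have hk' : MemLp (fun x => (k x : ℂ)) 2 ν := hk.ofReal
  have h1 : ∫ x, (k x : ℂ) * g x ∂ν = inner ℂ hk'.toLp g := by
    rw [L2.inner_def]
    refine integral_congr_ae ?_
    filter_upwards [hk'.coeFn_toLp] with x hx
    rw [hx]
    simp [mul_comm]
  rw [h1]
  refine (norm_inner_le_norm _ _).trans (mul_le_mul_of_nonneg_right ?_ (norm_nonneg g))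
  refine Lp.norm_le_norm_of_ae_le ?_
  filter_upwards [hk'.coeFn_toLp, hb.coeFn_toLp] with x hx hy
  rw [hx, hy, Complex.norm_real, Real.norm_eq_abs]
  exact (h x).trans (le_abs_self _)

theorem AEDisjoint.ae_eq_zero_or {f g : Ω → ℝ}
    (h : AEDisjoint ν (Function.support f) (Function.support g)) :
    ∀ᵐ x ∂ν, f x = 0 ∨ g x = 0 := by
  rw [ae_iff]
  refine measure_mono_null (fun x hx => ?_) h
  exact not_or.mp hx

/-- Dominated convergence: `0 ≤ F i ≤ f` gives `(F i - f)² ≤ f²`. -/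
theorem tendsto_norm_toLp_sub {F : ℕ → Ω → ℝ} (hF : ∀ i, MemLp (F i) 2 ν) {f : Ω → ℝ}
    (hf : MemLp f 2 ν) (h0 : ∀ i, ∀ᵐ x ∂ν, 0 ≤ F i x) (hle : ∀ i, ∀ᵐ x ∂ν, F i x ≤ f x)
    (hlim : ∀ᵐ x ∂ν, Tendsto (fun i => F i x) atTop (𝓝 (f x))) :
    Tendsto (fun i => ‖((hF i).sub hf).toLp‖) atTop (𝓝 0) := by
  have h1 (i : ℕ) : ‖((hF i).sub hf).toLp‖ = √(∫ x, (F i x - f x) ^ 2 ∂ν) := by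
    rw [← Real.sqrt_sq (norm_nonneg _), ← real_inner_self_eq_norm_sq, L2.inner_def]
    congr 1
    refine integral_congr_ae ?_
    filter_upwards [((hF i).sub hf).coeFn_toLp] with x hx
    rw [hx, real_inner_self_eq_norm_sq, Pi.sub_apply, Real.norm_eq_abs, sq_abs]
  simp only [h1]
  rw [← Real.sqrt_zero]
  refine (Real.continuous_sqrt.tendsto 0).comp ?_
  rw [← integral_zero Ω ℝ (μ := ν)]
  refine tendsto_integral_of_dominated_convergence (fun x => f x ^ 2)
    (fun i => ((hF i).sub hf).1.pow 2) hf.integrable_sq (fun i => ?_) ?_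
  · filter_upwards [h0 i, hle i] with x h2 h3
    rw [Real.norm_of_nonneg (sq_nonneg _)]
    nlinarith
  · filter_upwards [hlim] with x hx
    simpa using (hx.sub_const (f x)).pow 2

variable [IsProbabilityMeasure ν]

/-- A constant has L² norm equal to its absolute value because `ν` has mass one. The Lipschitz bound
uses this in `x` with `c = |d y|`, then in `y` with `c = ‖d‖`. -/
theorem norm_toLp_abs_add_const_le {d : Ω → ℝ} (hd : MemLp d 2 ν) {c : ℝ} (hc : 0 ≤ c)
    (h : MemLp (fun x => |d x| + c) 2 ν) : ‖h.toLp‖ ≤ ‖hd.toLp‖ + c := by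
  have h1 : h.toLp = hd.norm.toLp + (memLp_const c : MemLp (fun _ : Ω => c) 2 ν).toLp :=
    MemLp.toLp_add hd.norm (memLp_const c)
  rw [h1]
  refine (norm_add_le _ _).trans (add_le_add (le_of_eq ?_) (le_of_eq ?_))
  · rw [Lp.norm_toLp, Lp.norm_toLp, eLpNorm_norm]
  · rw [Lp.norm_toLp, eLpNorm_const c two_ne_zero (IsProbabilityMeasure.ne_zero ν)]
    simp [abs_of_nonneg hc]

theorem memLp_signedMin {f : Ω → ℝ} (hf : MemLp f 2 ν) (c : ℝ) :
    MemLp (fun x => signedMin (f x) c) 2 ν :=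
  ((memLp_posPart hf).inf (memLp_const (max c 0))).sub
    ((memLp_negPart hf).inf (memLp_const (-min c 0)))

theorem quantization_apply_ae {f : Ω → ℝ} (hf : MemLp f 2 ν) (g : Lp ℂ 2 ν) :
    quantization ν f hf g =ᵐ[ν] fun y => ∫ x, (signedMin (f x) (f y) : ℂ) * g x ∂ν := by
  rw [quantization, sub_apply]
  filter_upwards [Lp.coeFn_sub (minKernelOp ν _ (memLp_posPart hf) g)
    (minKernelOp ν _ (memLp_negPart hf) g), minKernelOp_apply_ae _ (memLp_posPart hf) g,
    minKernelOp_apply_ae _ (memLp_negPart hf) g] with y h1 h2 h3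
  rw [h1, Pi.sub_apply, h2, h3, ← integral_sub]
  · simp only [signedMin, Complex.ofReal_sub, sub_mul]
  · exact integrable_ofReal_mul ((memLp_posPart hf).inf (memLp_const _)) g
  · exact integrable_ofReal_mul ((memLp_negPart hf).inf (memLp_const _)) g

/-- The quantization is Lipschitz as a map from `L²` to the bounded operators. -/
theorem norm_quantization_sub_le {f f' : Ω → ℝ} (hf : MemLp f 2 ν) (hf' : MemLp f' 2 ν) :
    ‖quantization ν f hf - quantization ν f' hf'‖ ≤ 4 * ‖(hf.sub hf').toLp‖ := by
  have hd := hf.sub hf'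
  refine ContinuousLinearMap.opNorm_le_bound _ (by positivity) fun g => ?_
  -- With `d = f - f'`, the kernel contributes a factor 2 and `‖|d| + ‖d‖‖ ≤ 2 ‖d‖` another, hence
  -- the 4.
  have h1 : ‖(quantization ν f hf - quantization ν f' hf') g‖ ≤
      2 * ‖g‖ * ‖(memLp_bound hd).toLp‖ := by
    refine Lp.norm_le_mul_norm_of_ae_le_mul ?_
    rw [sub_apply]
    filter_upwards [Lp.coeFn_sub (quantization ν f hf g) (quantization ν f' hf' g),
      quantization_apply_ae hf g, quantization_apply_ae hf' g,
      (memLp_bound hd).coeFn_toLp] with y h1 h2 h3 h4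
    have hb : MemLp (fun x => |(f - f') x| + |(f - f') y|) 2 ν := hd.norm.add (memLp_const _)
    rw [h1, h4, Pi.sub_apply, h2, h3, ← integral_sub
      (integrable_ofReal_mul (memLp_signedMin hf (f y)) g)
      (integrable_ofReal_mul (memLp_signedMin hf' (f' y)) g)]
    simp only [← sub_mul, ← Complex.ofReal_sub]
    refine (norm_integral_ofReal_mul_le
      ((memLp_signedMin hf (f y)).sub (memLp_signedMin hf' (f' y))) (hb.const_smul (2 : ℝ))
      (fun x => abs_signedMin_sub_le _ _ _ _) g).trans ?_
    rw [MemLp.toLp_const_smul _ hb, norm_smul, Real.norm_of_nonneg (by norm_num : (0 : ℝ) ≤ 2),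
      Real.norm_of_nonneg (by positivity)]
    nlinarith [norm_toLp_abs_add_const_le hd (abs_nonneg ((f - f') y)) hb, norm_nonneg g]
  have h2 : ‖(memLp_bound hd).toLp‖ ≤ ‖hd.toLp‖ + ‖hd.toLp‖ := by
    have h3 : MemLp (fun y => |(f - f') y| + ‖hd.toLp‖) 2 ν := hd.norm.add (memLp_const _)
    convert norm_toLp_abs_add_const_le hd (norm_nonneg hd.toLp) h3 using 4 with y
    exact add_comm _ _
  nlinarith [norm_nonneg g]

/-! ### Operator identities read off from the kernel. -/

theorem quantization_indicator_one {A : Set Ω} (hA : MeasurableSet A) :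
    quantization ν (A.indicator fun _ => (1 : ℝ)) (memLp_chi hA) = qMeasureOp ν A hA := by
  ext1 g
  refine Lp.ext ?_
  rw [qMeasureOp, decoherenceOp, InnerProductSpace.rankOne_apply, chi,
    L2.inner_indicatorConstLp_one]
  filter_upwards [quantization_apply_ae (memLp_chi hA) g,
    Lp.coeFn_smul (∫ x in A, g x ∂ν) (indicatorConstLp 2 hA (measure_ne_top ν A) (1 : ℂ)),
    indicatorConstLp_coeFn (p := 2) (hs := hA) (hμs := measure_ne_top ν A) (c := (1 : ℂ))]
    with y h1 h2 h3
  rw [h1, h2, Pi.smul_apply, h3, ← integral_indicator hA]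
  by_cases hy : y ∈ A
  -- On characteristic functions the kernel is the product `χ_A(x) χ_A(y)`, which has rank one.
  · simp only [Set.indicator_of_mem hy, smul_eq_mul, mul_one]
    congr 1 with x
    by_cases hx : x ∈ A <;> simp [hx, signedMin]
  · simp [Set.indicator_of_notMem hy, signedMin_zero_right]

theorem quantization_smul (α : ℝ) {f : Ω → ℝ} (hf : MemLp f 2 ν) :
    quantization ν (α • f) (hf.const_smul α) = (α : ℂ) • quantization ν f hf := by
  ext1 g
  refine Lp.ext ?_
  rw [smul_apply]
  filter_upwards [quantization_apply_ae (hf.const_smul α) g, quantization_apply_ae hf g,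
    Lp.coeFn_smul (α : ℂ) (quantization ν f hf g)] with y h1 h2 h3
  rw [h1, h3, Pi.smul_apply (α : ℂ), h2, smul_eq_mul, ← integral_const_mul]
  simp only [Pi.smul_apply, smul_eq_mul, signedMin_mul, Complex.ofReal_mul, mul_assoc]

theorem quantization_add_add {f g h : Ω → ℝ} (hf : MemLp f 2 ν) (hg : MemLp g 2 ν)
    (hh : MemLp h 2 ν) (hfg : AEDisjoint ν (Function.support f) (Function.support g))
    (hfh : AEDisjoint ν (Function.support f) (Function.support h))
    (hgh : AEDisjoint ν (Function.support g) (Function.support h)) :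
    quantization ν (f + g + h) ((hf.add hg).add hh) =
      quantization ν (f + g) (hf.add hg) + quantization ν (f + h) (hf.add hh) +
        quantization ν (g + h) (hg.add hh) - quantization ν f hf - quantization ν g hg -
        quantization ν h hh := by
  ext1 φ
  refine Lp.ext ?_
  simp only [add_apply, sub_apply]
  have hd : ∀ᵐ x ∂ν, (f x = 0 ∨ g x = 0) ∧ (f x = 0 ∨ h x = 0) ∧ (g x = 0 ∨ h x = 0) :=
    (AEDisjoint.ae_eq_zero_or hfg).and
      ((AEDisjoint.ae_eq_zero_or hfh).and (AEDisjoint.ae_eq_zero_or hgh))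
  -- Turns the L² class on the right, one sum or difference at a time, into a pointwise combination
  -- of kernel integrals.
  refine EventuallyEq.trans ?_ (((((((quantization_apply_ae (hf.add hg) φ).add
    (quantization_apply_ae (hf.add hh) φ)).symm.trans (Lp.coeFn_add _ _).symm).symm.add
    (quantization_apply_ae (hg.add hh) φ)).symm.trans (Lp.coeFn_add _ _).symm).symm.sub
    (quantization_apply_ae hf φ) |>.symm.trans (Lp.coeFn_sub _ _).symm).symm.sub
    (quantization_apply_ae hg φ) |>.symm.trans (Lp.coeFn_sub _ _).symm |>.symm.sub
    (quantization_apply_ae hh φ) |>.symm.trans (Lp.coeFn_sub _ _).symm)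
  refine (quantization_apply_ae _ φ).trans ?_
  filter_upwards [hd] with y hy
  have hi {u : Ω → ℝ} (hu : MemLp u 2 ν) :
      Integrable (fun x => (signedMin (u x) (u y) : ℂ) * φ x) ν :=
    integrable_ofReal_mul (memLp_signedMin hu (u y)) φ
  have h1 := hi (hf.add hg)
  have h2 := hi (hf.add hh)
  have h3 := hi (hg.add hh)
  simp only [Pi.add_apply, Pi.sub_apply] at h1 h2 h3 ⊢
  have h4 := h1.add h2
  have h5 := h4.add h3
  have h6 := h5.sub (hi hf)
  have h7 := h6.sub (hi hg)
  rw [← integral_add h1 h2]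
  refine Eq.trans ?_ (congrArg (· - _ - _ - _) (integral_add h4 h3))
  refine Eq.trans ?_ (congrArg (· - _ - _) (integral_sub h5 (hi hf)))
  refine Eq.trans ?_ (congrArg (· - _) (integral_sub h6 (hi hg)))
  refine Eq.trans ?_ (integral_sub h7 (hi hh))
  refine integral_congr_ae ?_
  filter_upwards [hd] with x hx
  rw [signedMin_add_add hx.1 hx.2.1 hx.2.2 hy.1 hy.2.1 hy.2.2]
  push_cast
  ring

/-! ### Positivity of the quantization. -/

/-- The kernel `min (f x) (f y)` is positive semidefinite, by the layer cake formula
`min a b = ∫ 1_{t < a} 1_{t < b} dt`. -/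
theorem exists_integral_min_eq {f : Ω → ℝ} (hf : MemLp f 2 ν) (hm : Measurable f)
    (h0 : ∀ x, 0 ≤ f x) {g : Ω → ℂ} (hg : MemLp g 2 ν) (hgm : Measurable g) :
    ∃ r : ℝ, 0 ≤ r ∧
      ∫ y, (∫ x, ((min (f x) (f y) : ℝ) : ℂ) * g x ∂ν) * starRingEnd ℂ (g y) ∂ν = r := by
  -- With these slices the quadratic form becomes `∫₀^∞ |∫ φ x t dν(x)|² dt`, which is the witness
  -- `r`.
  let φ : Ω → ℝ → ℂ := fun x t => if t < f x then g x else 0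
  let F : (Ω × Ω) → ℝ → ℂ := fun p t => starRingEnd ℂ (φ p.1 t) * φ p.2 t
  have hF (p : Ω × Ω) (t : ℝ) : F p t =
      if t < min (f p.2) (f p.1) then g p.2 * starRingEnd ℂ (g p.1) else 0 := by
    simp only [F, φ, lt_min_iff]
    by_cases h1 : t < f p.1 <;> by_cases h2 : t < f p.2 <;> simp [h1, h2, mul_comm]
  have hFm : Measurable (Function.uncurry F) := by
    have h1 : Function.uncurry F = fun q : (Ω × Ω) × ℝ =>
        if q.2 < min (f q.1.2) (f q.1.1) then g q.1.2 * starRingEnd ℂ (g q.1.1) else 0 := by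
      ext q
      exact hF q.1 q.2
    rw [h1]
    refine Measurable.ite (measurableSet_lt (by fun_prop) (by fun_prop)) ?_ measurable_const
    exact (hgm.comp (by fun_prop)).mul
      (Complex.continuous_conj.measurable.comp (hgm.comp (by fun_prop)))
  have hmin (p : Ω × Ω) : 0 ≤ min (f p.2) (f p.1) := le_min (h0 _) (h0 _)
  have hint (p : Ω × Ω) : ∫ t in Set.Ioi (0 : ℝ), F p t =
      (min (f p.2) (f p.1) : ℝ) * (g p.2 * starRingEnd ℂ (g p.1)) := by
    simp only [hF]
    rw [integral_Ioi_ite_lt (hmin p), Complex.real_smul]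
  have hfg : Integrable (fun x => f x * ‖g x‖) ν :=
    MemLp.integrable_mul (p := 2) (q := 2) hf hg.norm
  have hgi : Integrable (fun x => ‖g x‖) ν := hg.norm.integrable one_le_two
  -- Fubini applies because the `t`-integral of `‖F‖` is at most `f(y) |g(y)| |g(x)|`, a product of
  -- integrable functions.
  have hFi : Integrable (Function.uncurry F)
      ((ν.prod ν).prod (volume.restrict (Set.Ioi (0 : ℝ)))) := by
    refine (integrable_prod_iff hFm.aestronglyMeasurable).mpr ⟨ae_of_all _ fun p => ?_, ?_⟩
    · have h1 : (fun t => Function.uncurry F (p, t)) =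
          (Set.Iio (min (f p.2) (f p.1))).indicator fun _ => g p.2 * starRingEnd ℂ (g p.1) := by
        ext t
        simp only [Function.uncurry_apply_pair, hF, Set.indicator_apply, Set.mem_Iio]
      rw [h1]
      refine (integrable_indicator_iff measurableSet_Iio).mpr (integrableOn_const ?_)
      rw [Measure.restrict_apply measurableSet_Iio, Set.inter_comm, Set.Ioi_inter_Iio]
      simp
    · have h1 : (fun p => ∫ t in Set.Ioi (0 : ℝ), ‖Function.uncurry F (p, t)‖) =
          fun p => min (f p.2) (f p.1) * ‖g p.2 * starRingEnd ℂ (g p.1)‖ := by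
        ext p
        simp only [Function.uncurry_apply_pair, hF, apply_ite norm, norm_zero]
        rw [integral_Ioi_ite_lt (hmin p), smul_eq_mul]
      rw [h1]
      refine Integrable.mono' (hfg.mul_prod hgi) (Measurable.aestronglyMeasurable ?_)
        (ae_of_all _ fun p => ?_)
      · exact ((hm.comp measurable_snd).min (hm.comp measurable_fst)).mul
          ((hgm.comp measurable_snd).mul (Complex.continuous_conj.measurable.comp
            (hgm.comp measurable_fst))).norm
      · rw [norm_mul, norm_mul, RCLike.norm_conj, Real.norm_of_nonneg (hmin p),
          Real.norm_of_nonneg (by positivity), mul_comm ‖g p.2‖, ← mul_assoc]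
        gcongr
        exact min_le_right _ _
  refine ⟨∫ t in Set.Ioi (0 : ℝ), ‖∫ x, φ x t ∂ν‖ ^ 2,
    integral_nonneg fun t => by positivity, ?_⟩
  have h1 : ∀ t, ∫ p, F p t ∂(ν.prod ν) = ((‖∫ x, φ x t ∂ν‖ ^ 2 : ℝ) : ℂ) := fun t => by
    rw [integral_prod_mul (fun x => starRingEnd ℂ (φ x t)) (fun x => φ x t), integral_conj,
      ← Complex.normSq_eq_conj_mul_self, Complex.normSq_eq_norm_sq]
  rw [← integral_complex_ofReal, ← integral_congr_ae (ae_of_all _ h1),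
    ← integral_integral_swap hFi]
  have h2 := hFi.integral_prod_left
  simp only [Function.uncurry_apply_pair] at h2
  rw [integral_prod _ h2]
  simp only [hint, ← integral_mul_const, mul_assoc]

theorem isPositive_quantization {f : Ω → ℝ} (hf : MemLp f 2 ν) (h0 : ∀ᵐ x ∂ν, 0 ≤ f x) :
    (quantization ν f hf).IsPositive := by
  refine (ContinuousLinearMap.isPositive_iff_complex _).mpr fun g => ?_
  -- The layer cake argument needs a measurable function that is nonnegative everywhere; `max f₁ 0`
  -- is such a representative of `f`.
  obtain ⟨f₁, hf₁m, hf₁⟩ := hf.1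
  have hff : f =ᵐ[ν] fun x => max (f₁ x) 0 := by
    filter_upwards [h0, hf₁] with x h1 h2
    rw [← h2, max_eq_left h1]
  obtain ⟨r, hr, h⟩ := exists_integral_min_eq (hf.ae_eq hff)
    (hf₁m.measurable.max measurable_const) (fun x => le_max_right _ _) (Lp.memLp g)
    (Lp.stronglyMeasurable g).measurable
  have h1 : inner ℂ g (quantization ν f hf g) = (r : ℂ) := by
    rw [L2.inner_def, ← h]
    refine integral_congr_ae ?_
    filter_upwards [quantization_apply_ae hf g, hff] with y h1 h2
    rw [h1, RCLike.inner_apply, h2]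
    congr 1
    refine integral_congr_ae ?_
    filter_upwards [hff] with x h3
    rw [h3, signedMin_of_nonneg (le_max_right _ _) (le_max_right _ _)]
  rw [← inner_conj_symm, h1]
  simpa using hr

/-- Shows `f̂` as a difference of two positive operators, so that its `τ`-value is real. -/
theorem quantization_eq_sub {f : Ω → ℝ} (hf : MemLp f 2 ν) :
    quantization ν f hf = quantization ν (fun x => max (f x) 0) (memLp_posPart hf) -
      quantization ν (fun x => -min (f x) 0) (memLp_negPart hf) := by
  rw [quantization_of_nonneg _ _ fun x => le_max_right _ _,
    quantization_of_nonneg _ _ fun x => neg_nonneg.mpr (min_le_right _ _), quantization]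

end Quantization

end QMeasure

/-! ### The properties of the `q`-integral. -/

theorem corollary3p3 {Ω : Type u} [MeasurableSpace Ω] (ν : Measure Ω) [IsProbabilityMeasure ν]
    (ρ : Lp ℂ 2 ν →L[ℂ] Lp ℂ 2 ν) (hρ : QMeasure.IsDensityOperator ρ) :
    -- the traces that define the `q`-measure and the `q`-integral exist and are real
    ((∀ (A : Set Ω) (hA : MeasurableSet A),
        QMeasure.HasTrace (ρ ∘L QMeasure.qMeasureOp ν A hA) (QMeasure.qMeasure ρ A hA) ∧
        (QMeasure.qMeasure ρ A hA).im = 0) ∧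
      (∀ (f : Ω → ℝ) (hf : MemLp f 2 ν),
        QMeasure.HasTrace (ρ ∘L QMeasure.quantization ν f hf) (QMeasure.qIntegral ρ f hf) ∧
        (QMeasure.qIntegral ρ f hf).im = 0)) ∧
    -- (a)
    (∀ (A : Set Ω) (hA : MeasurableSet A),
      QMeasure.qIntegral ρ (A.indicator fun _ => (1 : ℝ)) (QMeasure.memLp_chi hA) =
        QMeasure.qMeasure ρ A hA) ∧
    -- (b)
    (∀ (α : ℝ) (f : Ω → ℝ) (hf : MemLp f 2 ν),
      QMeasure.qIntegral ρ (α • f) (hf.const_smul α) = (α : ℂ) * QMeasure.qIntegral ρ f hf) ∧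
    -- (c)
    (∀ (F : ℕ → Ω → ℝ) (hF : ∀ i, MemLp (F i) 2 ν) (f : Ω → ℝ) (hf : MemLp f 2 ν),
      (∀ i, ∀ᵐ x ∂ν, 0 ≤ F i x) →
      (∀ᵐ x ∂ν, Monotone fun i => F i x) →
      (∀ᵐ x ∂ν, Tendsto (fun i => F i x) atTop (𝓝 (f x))) →
      Tendsto (fun i => QMeasure.qIntegral ρ (F i) (hF i)) atTop
        (𝓝 (QMeasure.qIntegral ρ f hf))) ∧
    -- (d)
    (∀ (f : Ω → ℝ) (hf : MemLp f 2 ν), (∀ᵐ x ∂ν, 0 ≤ f x) → 0 ≤ QMeasure.qIntegral ρ f hf) ∧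
    -- (e)
    (∀ (f g h : Ω → ℝ) (hf : MemLp f 2 ν) (hg : MemLp g 2 ν) (hh : MemLp h 2 ν),
      AEDisjoint ν (Function.support f) (Function.support g) →
      AEDisjoint ν (Function.support f) (Function.support h) →
      AEDisjoint ν (Function.support g) (Function.support h) →
      QMeasure.qIntegral ρ (f + g + h) ((hf.add hg).add hh) =
        QMeasure.qIntegral ρ (f + g) (hf.add hg) + QMeasure.qIntegral ρ (f + h) (hf.add hh) +
          QMeasure.qIntegral ρ (g + h) (hg.add hh) -
          QMeasure.qIntegral ρ f hf - QMeasure.qIntegral ρ g hg - QMeasure.qIntegral ρ h hh) ∧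
    -- (f)
    (∀ (f : Ω → ℝ) (hf : MemLp f 2 ν) (A B C : Set Ω)
      (hA : MeasurableSet A) (hB : MeasurableSet B) (hC : MeasurableSet C),
      Disjoint A B → Disjoint A C → Disjoint B C →
      QMeasure.qSetIntegral ρ (A ∪ B ∪ C) ((hA.union hB).union hC) f hf =
        QMeasure.qSetIntegral ρ (A ∪ B) (hA.union hB) f hf +
          QMeasure.qSetIntegral ρ (A ∪ C) (hA.union hC) f hf +
          QMeasure.qSetIntegral ρ (B ∪ C) (hB.union hC) f hf -
          QMeasure.qSetIntegral ρ A hA f hf - QMeasure.qSetIntegral ρ B hB f hf -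
          QMeasure.qSetIntegral ρ C hC f hf) := by
  obtain ⟨τ, hτ, hpos⟩ := hρ.exists_functional
  have hμ (A : Set Ω) (hA : MeasurableSet A) :
      QMeasure.qMeasure ρ A hA = τ (QMeasure.qMeasureOp ν A hA) := (hτ _).trace_eq
  have hI (f : Ω → ℝ) (hf : MemLp f 2 ν) :
      QMeasure.qIntegral ρ f hf = τ (QMeasure.quantization ν f hf) := (hτ _).trace_eq
  have hposI (f : Ω → ℝ) (hf : MemLp f 2 ν) (h0 : ∀ᵐ x ∂ν, 0 ≤ f x) :
      0 ≤ QMeasure.qIntegral ρ f hf := by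
    rw [hI]
    exact hpos _ (QMeasure.isPositive_quantization hf h0)
  have hadd (f g h : Ω → ℝ) (hf : MemLp f 2 ν) (hg : MemLp g 2 ν) (hh : MemLp h 2 ν)
      (hfg : AEDisjoint ν (Function.support f) (Function.support g))
      (hfh : AEDisjoint ν (Function.support f) (Function.support h))
      (hgh : AEDisjoint ν (Function.support g) (Function.support h)) :
      QMeasure.qIntegral ρ (f + g + h) ((hf.add hg).add hh) =
        QMeasure.qIntegral ρ (f + g) (hf.add hg) + QMeasure.qIntegral ρ (f + h) (hf.add hh) +
          QMeasure.qIntegral ρ (g + h) (hg.add hh) -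
          QMeasure.qIntegral ρ f hf - QMeasure.qIntegral ρ g hg - QMeasure.qIntegral ρ h hh := by
    simp only [hI, QMeasure.quantization_add_add hf hg hh hfg hfh hgh, map_add, map_sub]
  refine ⟨⟨fun A hA => ⟨hμ A hA ▸ hτ _, ?_⟩, fun f hf => ⟨hI f hf ▸ hτ _, ?_⟩⟩,
    fun A hA => ?_, fun α f hf => ?_, fun F hF f hf h0 hmono hlim => ?_, hposI, hadd,
    fun f hf A B C hA hB hC hAB hAC hBC => ?_⟩
  · rw [hμ]
    exact (Complex.nonneg_iff.mp (hpos _ (InnerProductSpace.isPositive_rankOne_self _))).2.symm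
  · rw [hI, QMeasure.quantization_eq_sub, map_sub, Complex.sub_im]
    rw [← (Complex.nonneg_iff.mp (hpos _ (QMeasure.isPositive_quantization
        (QMeasure.memLp_posPart hf) (ae_of_all _ fun x => le_max_right _ _)))).2,
      ← (Complex.nonneg_iff.mp (hpos _ (QMeasure.isPositive_quantization
        (QMeasure.memLp_negPart hf) (ae_of_all _ fun x =>
          neg_nonneg.mpr (min_le_right _ _))))).2, sub_zero]
  · rw [hI, hμ, QMeasure.quantization_indicator_one]
  · rw [hI, hI, QMeasure.quantization_smul, map_smul, smul_eq_mul]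
  · simp only [hI]
    -- Norm convergence of the quantizations suffices. Monotonicity serves only to bound each `F i`
    -- by the limit `f`.
    refine (τ.continuous.tendsto _).comp (tendsto_iff_norm_sub_tendsto_zero.mpr ?_)
    refine squeeze_zero (fun _ => norm_nonneg _)
      (fun i => QMeasure.norm_quantization_sub_le (hF i) hf) ?_
    rw [← mul_zero (4 : ℝ)]
    refine (QMeasure.tendsto_norm_toLp_sub hF hf h0 (fun i => ?_) hlim).const_mul 4
    filter_upwards [hmono, hlim] with x h1 h2
    exact h1.ge_of_tendsto h2 i
  · have hd {D E : Set Ω} (h : Disjoint D E) :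
        AEDisjoint ν (Function.support (D.indicator f)) (Function.support (E.indicator f)) :=
      (h.mono Set.support_indicator_subset Set.support_indicator_subset).aedisjoint
    have h1 : (A ∪ B ∪ C).indicator f = A.indicator f + B.indicator f + C.indicator f := by
      rw [Set.indicator_union_of_disjoint (hAC.union_left hBC),
        Set.indicator_union_of_disjoint hAB]
      rfl
    simp only [QMeasure.qSetIntegral, h1, Set.indicator_union_of_disjoint hAB,
      Set.indicator_union_of_disjoint hAC, Set.indicator_union_of_disjoint hBC]
    exact hadd _ _ _ (hf.indicator hA) (hf.indicator hB) (hf.indicator hC) (hd hAB) (hd hAC)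
      (hd hBC)
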